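/- Let $\Omega\subset\mathbb R^N$ be a bounded connected open set with Lipschitz continuous boundary, let $f:\Omega\times\mathbb R^N\to\overline{\mathbb R}=[-\infty,+\infty]$ be a Borel function, and let $F:W^{1,\infty}(\Omega)\to\overline{\mathbb R}$ be the supremal functional $$F(u)=\operatorname*{ess\,sup}_{x\in\Omega} f(x,Du(x)).$$ Assume that there is a sequence $(u_n)_{n\in\mathbb N}\subset W^{1,\infty}(\Omega)$ such that, writing $u_\xi(x):=\xi\cdot x$ for $\xi\in\mathbb R^N$, $$\lim_{n\to\infty}F(u_n)=\inf_{W^{1,\infty}(\Omega)}F\ (\in\overline{\mathbb R})\qquad\text{and}\qquad \limsup_{\xi\to0}F(u_n+u_\xi)=F(u_n)\quad\text{for every } n\in\mathbb N,$$ where $\limsup_{\xi\to 0}F(u_n+u_\xi)=\inf_{\delta>0}\sup_{|\xi|<\delta}F(u_n+u_\xi)$. For a topology $\tau$ on $W^{1,\infty}(\Omega)$ let $\Gamma_\tau(F)$ denote the lower semicontinuous envelope of $F$, i.e. the pointwise supremum of all $\tau$-lower semicontinuous functions $G:W^{1,\infty}(\Omega)\to\overline{\mathbb R}$ with $G\le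 F$. Then $\Gamma_\tau(F)$ is level convex, that is, $$\Gamma_\tau(F)(\theta v_1+(1-\theta)v_2)\le\max\{\Gamma_\tau(F)(v_1),\Gamma_\tau(F)(v_2)\}\qquad\text{for all }\theta\in(0,1),\ v_1,v_2\in W^{1,\infty}(\Omega),$$ when $\tau$ is any one of the following three topologies on $W^{1,\infty}(\Omega)$: 1. $\tau_\infty$, the topology induced by the inclusion $W^{1,\infty}(\Omega)\subset L^\infty(\Omega)$ (uniform convergence); 2. $w^*$, the weak* topology, i.e. the topology inherited through $u\mapsto(u,Du)$ from $L^\infty(\Omega)\times L^\infty(\Omega;\mathbb R^N)$ endowed with the weak* topology as the dual of $L^1(\Omega)\times L^1(\Omega;\mathbb R^N)$; 3. $w^*_{seq}$, the topology whose closed sets are exactly the sequentially $w^*$-closed subsets of $W^{1,\infty}(\Omega)$. -/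

import Mathlib

open MeasureTheory Filter Topology
open scoped ENNReal NNReal ContDiff

noncomputable section

/-- `ℝ^N` with the Euclidean norm. -/
abbrev RN (N : ℕ) : Type := EuclideanSpace ℝ (Fin N)

/-- The set `Ω` has Lipschitz continuous boundary: near every boundary point there are a unit
vector `e` and a Lipschitz function `γ` of the component orthogonal to `e`, such that `Ω` is
locally the set of points lying strictly above the graph of `γ` in the direction `e`. -/
def HasLipschitzBoundary {N : ℕ} (Ω : Set (RN N)) : Prop :=
  ∀ x₀ ∈ frontier Ω, ∃ U ∈ 𝓝 x₀, ∃ (e : RN N) (γ : RN N → ℝ) (K : ℝ≥0),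
    ‖e‖ = 1 ∧ LipschitzWith K γ ∧
      ∀ x ∈ U, x ∈ Ω ↔ γ (x - inner ℝ e x • e) < inner ℝ e x

/-! ### The space `W^{1,∞}(Ω)` -/

/-- `g` is the weak (distributional) gradient of `u` on `Ω`, tested against `φ ∈ C_c^∞(Ω)`. -/
def IsWeakGradient {N : ℕ} (Ω : Set (RN N)) (u : RN N → ℝ) (g : RN N → RN N) : Prop :=
  ∀ φ : RN N → ℝ, ContDiff ℝ ∞ φ → HasCompactSupport φ → tsupport φ ⊆ Ω →
    ∀ v : RN N, ∫ x in Ω, u x * fderiv ℝ φ x v = - ∫ x in Ω, inner ℝ (g x) v * φ x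

theorem IsWeakGradient.congr {N : ℕ} {Ω : Set (RN N)} {u u' : RN N → ℝ} {g g' : RN N → RN N}
    (h : IsWeakGradient Ω u g) (hu : u' =ᵐ[volume.restrict Ω] u)
    (hg : g' =ᵐ[volume.restrict Ω] g) : IsWeakGradient Ω u' g' := by
  intro φ h1 h2 h3 v
  have e1 : ∫ x in Ω, u' x * fderiv ℝ φ x v = ∫ x in Ω, u x * fderiv ℝ φ x v :=
    integral_congr_ae (by filter_upwards [hu] with x hx; rw [hx])
  have e2 : ∫ x in Ω, inner ℝ (g' x) v * φ x = ∫ x in Ω, inner ℝ (g x) v * φ x :=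
    integral_congr_ae (by filter_upwards [hg] with x hx; rw [hx])
  rw [e1, e2]
  exact h φ h1 h2 h3 v

theorem integrable_Lp_top_mul_fderiv {N : ℕ} {Ω : Set (RN N)} (u : Lp ℝ ∞ (volume.restrict Ω))
    {φ : RN N → ℝ} (hφ : ContDiff ℝ ∞ φ) (hc : HasCompactSupport φ) (v : RN N) :
    Integrable (fun x => u x * fderiv ℝ φ x v) (volume.restrict Ω) := by
  have hcont : Continuous fun x => fderiv ℝ φ x v :=
    (hφ.continuous_fderiv (by simp)).clm_apply continuous_const
  have hi : Integrable (fun x => fderiv ℝ φ x v) (volume.restrict Ω) :=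
    (hcont.integrable_of_hasCompactSupport (hc.fderiv_apply (𝕜 := ℝ) v)).mono_measure
      Measure.restrict_le_self
  exact hi.essSup_smul (R := ℝ) (Lp.aestronglyMeasurable u)
    (by simpa [eLpNorm_exponent_top, eLpNormEssSup] using (Lp.eLpNorm_lt_top u).ne)

theorem integrable_Lp_top_inner_mul {N : ℕ} {Ω : Set (RN N)}
    (g : Lp (RN N) ∞ (volume.restrict Ω)) {φ : RN N → ℝ} (hφ : Continuous φ)
    (hc : HasCompactSupport φ) (v : RN N) :
    Integrable (fun x => inner ℝ (g x) v * φ x) (volume.restrict Ω) := by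
  have hi : Integrable φ (volume.restrict Ω) :=
    (hφ.integrable_of_hasCompactSupport hc).mono_measure Measure.restrict_le_self
  have hm : MemLp (fun x => inner ℝ (g x) v) ∞ (volume.restrict Ω) :=
    (Lp.memLp g).inner_const v
  exact hi.essSup_smul (R := ℝ) hm.1
    (by simpa [eLpNorm_exponent_top, eLpNormEssSup] using hm.2.ne)

/-- The Sobolev space `W^{1,∞}(Ω)`: a function `u ∈ L^∞(Ω)` with weak gradient in
`L^∞(Ω; ℝ^N)` is recorded as the pair `(u, Du)`, so that `W^{1,∞}(Ω)` is a linear subspace of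
`L^∞(Ω) × L^∞(Ω; ℝ^N)` (for open `Ω`, the second component is determined by the first). -/
def W1inf {N : ℕ} (Ω : Set (RN N)) :
    Submodule ℝ (Lp ℝ ∞ (volume.restrict Ω) × Lp (RN N) ∞ (volume.restrict Ω)) where
  carrier := {p | IsWeakGradient Ω p.1 p.2}
  zero_mem' := by
    have h : IsWeakGradient Ω (0 : RN N → ℝ) (0 : RN N → RN N) := by
      intro φ _ _ _ v
      simp
    exact h.congr (Lp.coeFn_zero _ _ _) (Lp.coeFn_zero _ _ _)
  add_mem' := by
    intro p q hp hq
    have h : IsWeakGradient Ω (⇑p.1 + ⇑q.1) (⇑p.2 + ⇑q.2) := by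
      intro φ h1 h2 h3 v
      simp only [Pi.add_apply, add_mul, inner_add_left]
      rw [integral_add (integrable_Lp_top_mul_fderiv p.1 h1 h2 v)
          (integrable_Lp_top_mul_fderiv q.1 h1 h2 v),
        integral_add (integrable_Lp_top_inner_mul p.2 h1.continuous h2 v)
          (integrable_Lp_top_inner_mul q.2 h1.continuous h2 v), hp φ h1 h2 h3 v, hq φ h1 h2 h3 v]
      ring
    exact h.congr (Lp.coeFn_add _ _) (Lp.coeFn_add _ _)
  smul_mem' := by
    intro c p hp
    have h : IsWeakGradient Ω (c • ⇑p.1) (c • ⇑p.2) := by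
      intro φ h1 h2 h3 v
      simp only [Pi.smul_apply, smul_eq_mul, mul_assoc, real_inner_smul_left]
      rw [integral_const_mul, integral_const_mul, hp φ h1 h2 h3 v]
      ring
    exact h.congr (Lp.coeFn_smul _ _) (Lp.coeFn_smul _ _)

/-- The weak gradient `Du` of `u ∈ W^{1,∞}(Ω)`. -/
def W1inf.grad {N : ℕ} {Ω : Set (RN N)} (u : W1inf Ω) : Lp (RN N) ∞ (volume.restrict Ω) :=
  u.1.2

theorem memLp_linear {N : ℕ} {Ω : Set (RN N)} (hΩ : IsOpen Ω) (hb : Bornology.IsBounded Ω)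
    (ξ : RN N) : MemLp (fun x : RN N => inner ℝ ξ x) ∞ (volume.restrict Ω) := by
  obtain ⟨R, hR⟩ := hb.exists_norm_le
  refine memLp_top_of_bound (by fun_prop) (‖ξ‖ * R) ?_
  filter_upwards [ae_restrict_mem hΩ.measurableSet] with x hx
  exact (norm_inner_le_norm ξ x).trans (by gcongr; exact hR x hx)

theorem memLp_const_top {N : ℕ} (Ω : Set (RN N)) (ξ : RN N) :
    MemLp (fun _ : RN N => ξ) ∞ (volume.restrict Ω) :=
  memLp_top_const ξ

theorem isWeakGradient_linear {N : ℕ} (Ω : Set (RN N)) (ξ : RN N) :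
    IsWeakGradient Ω (fun x => inner ℝ ξ x) (fun _ => ξ) := by
  intro φ h1 h2 h3 v
  have hsupp : ∀ x, x ∉ Ω → x ∉ tsupport φ := fun x hx hx' => hx (h3 hx')
  have hcd : Continuous fun x => fderiv ℝ φ x v :=
    (h1.continuous_fderiv (by simp)).clm_apply continuous_const
  have hcs := h2.fderiv_apply (𝕜 := ℝ) v
  have hlin : ∀ x, HasFDerivAt (fun y : RN N => inner ℝ ξ y) (innerSL ℝ ξ) x :=
    fun x => (innerSL ℝ ξ).hasFDerivAt
  rw [setIntegral_eq_integral_of_forall_compl_eq_zero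
      (fun x hx => by
        rw [fderiv_of_notMem_tsupport (𝕜 := ℝ) (hsupp x hx)]; simp),
    setIntegral_eq_integral_of_forall_compl_eq_zero
      (fun x hx => by rw [image_eq_zero_of_notMem_tsupport (hsupp x hx), mul_zero])]
  have key := integral_mul_fderiv_eq_neg_fderiv_mul_of_integrable (μ := (volume : Measure (RN N)))
    (f := fun x : RN N => inner ℝ ξ x) (g := φ) (v := v) ?_ ?_ ?_
    (fun x _ => (hlin x).differentiableAt)
    (fun x _ => (h1.differentiable (by simp)) x)
  · simpa [(hlin _).fderiv] using key
  · simp only [(hlin _).fderiv]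
    exact (continuous_const.mul h1.continuous).integrable_of_hasCompactSupport h2.mul_left
  · exact ((by fun_prop : Continuous fun x : RN N => inner ℝ ξ x).mul hcd
      ).integrable_of_hasCompactSupport hcs.mul_left
  · exact ((by fun_prop : Continuous fun x : RN N => inner ℝ ξ x).mul h1.continuous
      ).integrable_of_hasCompactSupport h2.mul_left

/-- The linear function `u_ξ(x) = ξ · x` as an element of `W^{1,∞}(Ω)`, `Ω` bounded and open. -/
def linearW1inf {N : ℕ} {Ω : Set (RN N)} (hΩ : IsOpen Ω) (hb : Bornology.IsBounded Ω)
    (ξ : RN N) : W1inf Ω :=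
  ⟨((memLp_linear hΩ hb ξ).toLp (fun x => inner ℝ ξ x), (memLp_const_top Ω ξ).toLp (fun _ => ξ)),
    (isWeakGradient_linear Ω ξ).congr (memLp_linear hΩ hb ξ).coeFn_toLp
      (memLp_const_top Ω ξ).coeFn_toLp⟩

/-! ### Supremal functionals -/

/-- The supremal functional `F(u) = ess sup_{x ∈ Ω} f(x, Du(x))` on `W^{1,∞}(Ω)`. -/
def supremalFunctional {N : ℕ} (Ω : Set (RN N)) (f : RN N → RN N → EReal) (u : W1inf Ω) : EReal :=
  essSup (fun x => f x (W1inf.grad u x)) (volume.restrict Ω)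

/-! ### Topologies on `W^{1,∞}(Ω)` -/

/-- The topology of uniform convergence, induced by the inclusion `W^{1,∞}(Ω) ⊆ L^∞(Ω)`. -/
@[reducible] def tauUniform {N : ℕ} (Ω : Set (RN N)) : TopologicalSpace (W1inf Ω) :=
  TopologicalSpace.induced (fun u => u.1.1) inferInstance

/-- The weak* topology, inherited from `L^∞(Ω) × L^∞(Ω; ℝ^N)` as the dual of
`L^1(Ω) × L^1(Ω; ℝ^N)`: the coarsest topology for which `u ↦ ∫_Ω u h` and `u ↦ ∫_Ω Du · H` are
continuous for all `h ∈ L^1(Ω)` and `H ∈ L^1(Ω; ℝ^N)`. -/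
@[reducible] def tauWeakStar {N : ℕ} (Ω : Set (RN N)) : TopologicalSpace (W1inf Ω) :=
  (⨅ h : Lp ℝ 1 (volume.restrict Ω),
      TopologicalSpace.induced (fun u : W1inf Ω => ∫ x in Ω, u.1.1 x * h x) inferInstance) ⊓
    ⨅ H : Lp (RN N) 1 (volume.restrict Ω),
      TopologicalSpace.induced (fun u : W1inf Ω => ∫ x in Ω, inner ℝ (W1inf.grad u x) (H x)) inferInstance

/-- The sequential modification `τ_seq` of a topology `τ`: its closed sets are exactly the
sequentially `τ`-closed sets. -/
@[reducible] def seqTopology {X : Type*} (τ : TopologicalSpace X) : TopologicalSpace X :=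
  TopologicalSpace.ofClosed {s | @IsSeqClosed X τ s}
    (fun _ _ h _ => (h 0).elim)
    (fun _ hA _ _ hx hp => fun s hs => hA hs (fun n => hx n s hs) hp)
    (by
      intro s hs t ht x p hx hp
      by_cases hfr : ∃ᶠ n in atTop, x n ∈ s
      · obtain ⟨k, hk, hks⟩ := extraction_of_frequently_atTop hfr
        exact Or.inl (hs hks (hp.comp hk.tendsto_atTop))
      · rw [not_frequently] at hfr
        obtain ⟨n, hn⟩ := hfr.exists_forall_of_atTop
        refine Or.inr (ht (x := fun m => x (m + n)) (fun m => ?_)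
          ((tendsto_add_atTop_iff_nat n).2 hp))
        exact (hx (m + n)).resolve_left (hn _ (Nat.le_add_left n m)))

theorem isClosed_seqTopology_iff {X : Type*} (τ : TopologicalSpace X) (s : Set X) :
    IsClosed[seqTopology τ] s ↔ @IsSeqClosed X τ s := by
  rw [← @isOpen_compl_iff X s (seqTopology τ)]
  change sᶜᶜ ∈ {s | @IsSeqClosed X τ s} ↔ _
  rw [compl_compl]
  rfl

/-! ### Relaxation -/

/-- The lower semicontinuous envelope `Γ_τ(F)`: the pointwise supremum of all `τ`-lower
semicontinuous functions `G ≤ F` with values in the extended reals. -/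
def relaxation {X : Type*} (τ : TopologicalSpace X) (F : X → EReal) : X → EReal :=
  sSup {G : X → EReal | @LowerSemicontinuous X EReal τ _ G ∧ G ≤ F}

/-- Level convexity: `F(θ x₁ + (1 - θ) x₂) ≤ F(x₁) ∨ F(x₂)` for all `θ ∈ (0,1)`. -/
def LevelConvex {X : Type*} [AddCommGroup X] [Module ℝ X] (F : X → EReal) : Prop :=
  ∀ θ : ℝ, 0 < θ → θ < 1 → ∀ x₁ x₂ : X, F (θ • x₁ + (1 - θ) • x₂) ≤ max (F x₁) (F x₂)

end

/-! Let `u₁`, `u₂` lie in a sublevel set `{F ≤ c}` and put `z = u₁ - u₂`. Choose a nondecreasing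
function `S` on the line with slopes only `0` and `1` and mean slope `θ`. Then `z_n = S(n z) / n`
differs from `θ z` by at most `1 / n`, while its gradient is almost everywhere `0` or `Dz`. Hence
`u₂ + z_n` converges uniformly to `θ u₁ + (1 - θ) u₂`, and its gradient is at almost every `x` equal
to `Du₁(x)` or `Du₂(x)`. Since the functional is an essential supremum, `F(u₂ + z_n) ≤ c`. The
gradients are bounded, so the convergence is weak* as well (`exists_seq_supremalFunctional_le`).

Thus convex combinations of points of `{F ≤ c}` lie in its closure for each of the three topologies.
The envelope satisfies `{Γ F < c} ⊆ closure {F ≤ c} ⊆ {Γ F ≤ c}`, and continuity of `x ↦ a x + b`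
carries the convexity property over to the closure (`levelConvex_relaxation`).

The analytic core is the chain rule for `S ∘ u`, where `S` is only Lipschitz with a right derivative
everywhere (`IsWeakGradient.comp_of_hasDerivWithinAt_Ioi`). It is obtained from the `C¹` chain rule,
itself proved by mollification. -/

open scoped Convolution

/-! ### Mollification of bounded functions and of their weak gradients -/

/-- The mollification of `w` at scale `1 / (n + 1)`. -/
noncomputable def mollify {N : ℕ} (n : ℕ) (w : RN N → ℝ) : RN N → ℝ :=
  (ContDiffBump.normed (⟨1 / (2 * ((n : ℝ) + 1)), 1 / ((n : ℝ) + 1), by positivity, by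
      rw [div_lt_div_iff₀ (by positivity) (by positivity)]
      have : (0 : ℝ) ≤ n := n.cast_nonneg
      linarith⟩ : ContDiffBump (0 : RN N)) volume) ⋆[ContinuousLinearMap.lsmul ℝ ℝ, volume] w

theorem exists_mollify_kernel {N : ℕ} (n : ℕ) :
    ∃ ρ : RN N → ℝ, (∀ w, mollify n w = ρ ⋆[ContinuousLinearMap.lsmul ℝ ℝ, volume] w) ∧
      ContDiff ℝ ∞ ρ ∧ HasCompactSupport ρ ∧ (∀ x, 0 ≤ ρ x) ∧ ∫ x, ρ x = 1 ∧
      tsupport ρ = Metric.closedBall 0 (1 / ((n : ℝ) + 1)) :=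
  ⟨_, fun _ => rfl, ContDiffBump.contDiff_normed _, ContDiffBump.hasCompactSupport_normed _,
    ContDiffBump.nonneg_normed _, ContDiffBump.integral_normed _,
    ContDiffBump.tsupport_normed_eq _⟩

/-- Convergence holds at Lebesgue points, because the outer radius of each bump is a fixed multiple,
namely `2`, of its inner radius. -/
theorem ae_tendsto_mollify {N : ℕ} {w : RN N → ℝ} (hw : LocallyIntegrable w) :
    ∀ᵐ x, Tendsto (fun n => mollify n w x) atTop (𝓝 (w x)) := by
  refine ContDiffBump.ae_convolution_tendsto_right_of_locallyIntegrable (K := 2) ?_ ?_ hw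
  · exact tendsto_one_div_add_atTop_nhds_zero_nat
  · refine Eventually.of_forall fun n => le_of_eq ?_
    have : (n : ℝ) + 1 ≠ 0 := by positivity
    change 1 / ((n : ℝ) + 1) = 2 * (1 / (2 * ((n : ℝ) + 1)))
    field_simp

theorem contDiff_mollify {N : ℕ} (n : ℕ) {w : RN N → ℝ} (hw : LocallyIntegrable w) :
    ContDiff ℝ ∞ (mollify n w) := by
  obtain ⟨ρ, h, hρ, hc, -⟩ := exists_mollify_kernel (N := N) n
  rw [h]
  exact hc.contDiff_convolution_left _ hρ hw

/-- The kernel is a probability density, so averaging cannot increase the bound. This gives the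
dominating functions in the chain rule. -/
theorem abs_mollify_le {N : ℕ} (n : ℕ) {w : RN N → ℝ} {M : ℝ} (hM : ∀ᵐ x, |w x| ≤ M) (x : RN N) :
    |mollify n w x| ≤ M := by
  obtain ⟨ρ, h, hρ, hc, h0, h1, -⟩ := exists_mollify_kernel (N := N) n
  rw [h, convolution_eq_swap]
  have hi : Integrable ρ := hρ.continuous.integrable_of_hasCompactSupport hc
  have := norm_integral_le_of_norm_le
    (f := fun t => (ContinuousLinearMap.lsmul ℝ ℝ) (ρ (x - t)) (w t))
    ((hi.comp_sub_left x).mul_const M) (by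
      filter_upwards [hM] with t ht
      simp only [ContinuousLinearMap.lsmul_apply, smul_eq_mul, norm_mul, Real.norm_eq_abs,
        abs_of_nonneg (h0 _)]
      exact mul_le_mul_of_nonneg_left ht (h0 _))
  rwa [integral_mul_const, integral_sub_left_eq_self, h1, one_mul] at this

/-- Away from the boundary, mollification commutes with weak differentiation. -/
theorem IsWeakGradient.fderiv_mollify {N : ℕ} {Ω : Set (RN N)} (hΩ : IsOpen Ω) {u : RN N → ℝ}
    {g : RN N → RN N} (h : IsWeakGradient Ω u g) (hu : LocallyIntegrable (Ω.indicator u)) {n : ℕ}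
    {x : RN N} (hx : Metric.closedBall x (1 / ((n : ℝ) + 1)) ⊆ Ω) (v : RN N) :
    fderiv ℝ (mollify n (Ω.indicator u)) x v =
      mollify n (Ω.indicator fun y => inner ℝ (g y) v) x := by
  obtain ⟨ρ, hm, hρ, hc, -, -, hs⟩ := exists_mollify_kernel (N := N) n
  have hρ1 : ContDiff ℝ 1 ρ := hρ.of_le (by simp)
  rw [hm, hm, (hc.hasFDerivAt_convolution_left _ hρ1 hu x).fderiv, convolution_eq_swap,
    convolution_eq_swap]
  have hint : Integrable fun t => ContinuousLinearMap.precompL (RN N)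
      (ContinuousLinearMap.lsmul ℝ ℝ) (fderiv ℝ ρ (x - t)) (Ω.indicator u t) := by
    have := (hc.fderiv (𝕜 := ℝ)).convolutionExists_left
      (ContinuousLinearMap.precompL (RN N) (ContinuousLinearMap.lsmul ℝ ℝ : ℝ →L[ℝ] ℝ →L[ℝ] ℝ))
      (hρ1.continuous_fderiv (by simp)) hu x
    exact (convolutionExistsAt_iff_integrable_swap).1 this
  rw [ContinuousLinearMap.integral_apply hint]
  -- The kernel reflected about `x` is an admissible test function: its support lies in the closed
  -- ball about `x`, which is inside `Ω`.
  have htest := h (fun y => ρ (x - y)) (hρ.comp (contDiff_const.sub contDiff_id))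
    (hc.comp_homeomorph (Homeomorph.subLeft x)) (by
      intro y hy
      have : x - y ∈ tsupport ρ :=
        tsupport_comp_subset_preimage ρ (f := fun y => x - y) (by fun_prop) hy
      rw [hs] at this
      apply hx
      simpa [dist_eq_norm, norm_sub_rev] using this) v
  have hd : ∀ y, fderiv ℝ (fun y => ρ (x - y)) y v = - fderiv ℝ ρ (x - y) v := by
    intro y
    have h1 := (hρ1.differentiable (by simp) (x - y)).hasFDerivAt.comp y
      ((hasFDerivAt_id y).const_sub x)
    have := h1.fderiv
    simp only [Function.comp_def] at this
    rw [this]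
    simp
  simp only [hd, mul_neg, integral_neg, neg_inj] at htest
  rw [← integral_indicator hΩ.measurableSet, ← integral_indicator hΩ.measurableSet] at htest
  refine (integral_congr_ae (.of_forall fun t => ?_)).trans
    (htest.trans (integral_congr_ae (.of_forall fun t => ?_)))
  · by_cases ht : t ∈ Ω <;> simp [ht, ContinuousLinearMap.precompL_apply, mul_comm]
  · by_cases ht : t ∈ Ω <;> simp [ht, mul_comm]

theorem ae_bound_indicator {N : ℕ} {Ω : Set (RN N)} (hΩ : IsOpen Ω) {u : RN N → ℝ}
    (hu : MemLp u ∞ (volume.restrict Ω)) : ∃ M : ℝ, ∀ᵐ x, |Ω.indicator u x| ≤ M := by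
  refine ⟨(eLpNorm u ∞ (volume.restrict Ω)).toReal, ?_⟩
  have h : ∀ᵐ x ∂volume.restrict Ω, ‖u x‖ ≤ (eLpNorm u ∞ (volume.restrict Ω)).toReal := by
    rw [eLpNorm_exponent_top]
    have hfin : eLpNormEssSup u (volume.restrict Ω) ≠ ⊤ := by
      simpa [eLpNorm_exponent_top] using hu.2.ne
    filter_upwards [enorm_ae_le_eLpNormEssSup u (volume.restrict Ω)] with x hx
    simpa using ENNReal.toReal_mono hfin hx
  rw [ae_restrict_iff' hΩ.measurableSet] at h
  filter_upwards [h] with x hx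
  by_cases hxΩ : x ∈ Ω
  · simpa [hxΩ] using hx hxΩ
  · simp [hxΩ]

theorem locallyIntegrable_indicator {N : ℕ} {Ω : Set (RN N)} (hΩ : IsOpen Ω)
    (hb : Bornology.IsBounded Ω) {u : RN N → ℝ} (hu : MemLp u ∞ (volume.restrict Ω)) :
    LocallyIntegrable (Ω.indicator u) := by
  have : IsFiniteMeasure (volume.restrict Ω) := ⟨by simpa using hb.measure_lt_top⟩
  exact ((integrable_indicator_iff hΩ.measurableSet).2 (hu.integrable le_top)).locallyIntegrable

/-! ### Chain rules for weak gradients -/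

theorem exists_abs_le_of_continuous {Φ : ℝ → ℝ} (hΦ : Continuous Φ) (M : ℝ) :
    ∃ C, ∀ t, |t| ≤ M → |Φ t| ≤ C := by
  obtain ⟨C, hC⟩ := (isCompact_Icc (a := -M) (b := M)).exists_bound_of_continuousOn hΦ.continuousOn
  exact ⟨C, fun t ht => hC t (abs_le.1 ht)⟩

/-- The chain rule for weak gradients of bounded functions and outer `C¹` functions. -/
theorem IsWeakGradient.comp_of_hasDerivAt {N : ℕ} {Ω : Set (RN N)} (hΩ : IsOpen Ω)
    (hb : Bornology.IsBounded Ω) {u : RN N → ℝ} {g : RN N → RN N} (h : IsWeakGradient Ω u g)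
    (hu : MemLp u ∞ (volume.restrict Ω)) (hg : MemLp g ∞ (volume.restrict Ω)) {Φ Φ' : ℝ → ℝ}
    (hΦ : ∀ t, HasDerivAt Φ (Φ' t) t) (hΦ' : Continuous Φ') :
    IsWeakGradient Ω (fun x => Φ (u x)) (fun x => Φ' (u x) • g x) := by
  intro φ h1 h2 h3 v
  have hΦc : Continuous Φ := continuous_iff_continuousAt.2 fun t => (hΦ t).continuousAt
  have hgv : MemLp (fun x => inner ℝ (g x) v) ∞ (volume.restrict Ω) := hg.inner_const v
  set U : RN N → ℝ := Ω.indicator u with hU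
  set G : RN N → ℝ := Ω.indicator fun x => inner ℝ (g x) v with hG
  have hUl : LocallyIntegrable U := locallyIntegrable_indicator hΩ hb hu
  have hGl : LocallyIntegrable G := locallyIntegrable_indicator hΩ hb hgv
  obtain ⟨M, hM⟩ := ae_bound_indicator hΩ hu
  obtain ⟨M', hM'⟩ := ae_bound_indicator hΩ hgv
  obtain ⟨C, hC⟩ := exists_abs_le_of_continuous hΦc M
  obtain ⟨C', hC'⟩ := exists_abs_le_of_continuous hΦ' M
  have hUs : ∀ n, ContDiff ℝ ∞ (mollify n U) := fun n => contDiff_mollify n hUl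
  have hGs : ∀ n, ContDiff ℝ ∞ (mollify n G) := fun n => contDiff_mollify n hGl
  have hdc : Continuous fun x => fderiv ℝ φ x v :=
    (h1.continuous_fderiv (by simp)).clm_apply continuous_const
  have hds : HasCompactSupport fun x => fderiv ℝ φ x v := h2.fderiv_apply (𝕜 := ℝ) v
  have lim1 : Tendsto (fun n => ∫ x, Φ (mollify n U x) * fderiv ℝ φ x v) atTop
      (𝓝 (∫ x, Φ (U x) * fderiv ℝ φ x v)) := by
    refine tendsto_integral_of_dominated_convergence (fun x => C * |fderiv ℝ φ x v|)
      (fun n => ((hΦc.comp (hUs n).continuous).mul hdc).aestronglyMeasurable)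
      ((hdc.integrable_of_hasCompactSupport hds).abs.const_mul C) (fun n => .of_forall fun x => ?_) ?_
    · rw [norm_mul]
      exact mul_le_mul_of_nonneg_right (hC _ (abs_mollify_le n hM x)) (abs_nonneg _)
    · filter_upwards [ae_tendsto_mollify hUl] with x hx
      exact ((hΦc.tendsto _).comp hx).mul_const _
  have lim2 : Tendsto (fun n => ∫ x, Φ' (mollify n U x) * mollify n G x * φ x) atTop
      (𝓝 (∫ x, Φ' (U x) * G x * φ x)) := by
    refine tendsto_integral_of_dominated_convergence (fun x => C' * M' * |φ x|)
      (fun n => (((hΦ'.comp (hUs n).continuous).mul (hGs n).continuous).mul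
        h1.continuous).aestronglyMeasurable)
      ((h1.continuous.integrable_of_hasCompactSupport h2).abs.const_mul _)
      (fun n => .of_forall fun x => ?_) ?_
    · rw [norm_mul, norm_mul]
      refine mul_le_mul_of_nonneg_right ?_ (abs_nonneg _)
      have := hC' _ (abs_mollify_le n hM x)
      exact mul_le_mul this (abs_mollify_le n hM' x) (abs_nonneg _) ((abs_nonneg _).trans this)
    · filter_upwards [ae_tendsto_mollify hUl, ae_tendsto_mollify hGl] with x hx hx'
      exact (((hΦ'.tendsto _).comp hx).mul hx').mul_const _
  -- The support of `φ` has a `δ`-neighbourhood inside `Ω`; once `1 / (n + 1) ≤ δ`, mollification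
  -- commutes with differentiation there, and only there is it needed.
  obtain ⟨δ, hδ, hsub⟩ := h2.isCompact.exists_cthickening_subset_open hΩ h3
  have heq : ∀ᶠ n : ℕ in atTop, ∫ x, Φ (mollify n U x) * fderiv ℝ φ x v =
      -∫ x, Φ' (mollify n U x) * mollify n G x * φ x := by
    filter_upwards [(tendsto_one_div_add_atTop_nhds_zero_nat (𝕜 := ℝ)).eventually_le_const hδ]
      with n hn
    have hd : ∀ x, HasFDerivAt (fun x => Φ (mollify n U x))
        (Φ' (mollify n U x) • fderiv ℝ (mollify n U) x) x := fun x =>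
      (hΦ _).comp_hasFDerivAt x (((hUs n).differentiable (by simp)) x).hasFDerivAt
    have hcomp : Continuous fun x => Φ (mollify n U x) := hΦc.comp (hUs n).continuous
    rw [integral_mul_fderiv_eq_neg_fderiv_mul_of_integrable ?_ ?_ ?_
      (fun x _ => (hd x).differentiableAt) (fun x _ => (h1.differentiable (by simp)) x)]
    · congr 1
      refine integral_congr_ae (.of_forall fun x => ?_)
      by_cases hx : x ∈ tsupport φ
      · have := h.fderiv_mollify hΩ hUl (n := n) (x := x)
          (((Metric.closedBall_subset_closedBall hn).trans
            (Metric.closedBall_subset_cthickening hx δ)).trans hsub) v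
        rw [← hU, ← hG] at this
        beta_reduce
        rw [(hd x).fderiv, smul_apply, this, smul_eq_mul]
      · simp [image_eq_zero_of_notMem_tsupport hx]
    · simp only [(hd _).fderiv]
      refine Continuous.integrable_of_hasCompactSupport (.mul ?_ h1.continuous) h2.mul_left
      exact ((hΦ'.comp (hUs n).continuous).smul
        ((hUs n).continuous_fderiv (by simp))).clm_apply continuous_const
    · exact (hcomp.mul hdc).integrable_of_hasCompactSupport hds.mul_left
    · exact (hcomp.mul h1.continuous).integrable_of_hasCompactSupport h2.mul_left
  have key := tendsto_nhds_unique (lim1.congr' heq) lim2.neg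
  have hsupp : ∀ x, x ∉ Ω → x ∉ tsupport φ := fun x hx hx' => hx (h3 hx')
  have e1 : ∫ x in Ω, Φ (U x) * fderiv ℝ φ x v = ∫ x, Φ (U x) * fderiv ℝ φ x v :=
    setIntegral_eq_integral_of_forall_compl_eq_zero fun x hx => by
      rw [fderiv_of_notMem_tsupport (𝕜 := ℝ) (hsupp x hx)]; simp
  have e2 : ∫ x in Ω, Φ' (U x) * G x * φ x = ∫ x, Φ' (U x) * G x * φ x :=
    setIntegral_eq_integral_of_forall_compl_eq_zero fun x hx => by
      rw [image_eq_zero_of_notMem_tsupport (hsupp x hx), mul_zero]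
  rw [← e1, ← e2] at key
  refine (setIntegral_congr_fun hΩ.measurableSet fun x hx => ?_).trans
    (key.trans (congrArg _ (setIntegral_congr_fun hΩ.measurableSet fun x hx => ?_)))
  · simp [hU, hx]
  · simp [hU, hG, hx, real_inner_smul_left]

/-- Used twice in the next chain rule: for a primitive of the outer function and for the outer
function itself. -/
theorem HasDerivWithinAt.tendsto_nat_mul_sub {F : ℝ → ℝ} {F' t : ℝ}
    (h : HasDerivWithinAt F F' (Set.Ioi t) t) :
    Tendsto (fun n : ℕ => ((n : ℝ) + 1) * (F (t + 1 / ((n : ℝ) + 1)) - F t)) atTop (𝓝 F') := by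
  rw [hasDerivWithinAt_iff_tendsto_slope' (by simp)] at h
  have h0 := tendsto_one_div_add_atTop_nhds_zero_nat (𝕜 := ℝ)
  have ht : Tendsto (fun n : ℕ => t + 1 / ((n : ℝ) + 1)) atTop (𝓝[>] t) := by
    refine tendsto_nhdsWithin_iff.2 ⟨by simpa using h0.const_add t, .of_forall fun n => ?_⟩
    have : 0 < 1 / ((n : ℝ) + 1) := by positivity
    simpa using this
  refine (h.comp ht).congr fun n => ?_
  simp [slope_def_field]
  ring

/-- The chain rule for weak gradients of bounded functions and outer Lipschitz functions that have
a right derivative everywhere. -/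
theorem IsWeakGradient.comp_of_hasDerivWithinAt_Ioi {N : ℕ} {Ω : Set (RN N)} (hΩ : IsOpen Ω)
    (hb : Bornology.IsBounded Ω) {u : RN N → ℝ} {g : RN N → RN N} (h : IsWeakGradient Ω u g)
    (hu : MemLp u ∞ (volume.restrict Ω)) (hg : MemLp g ∞ (volume.restrict Ω)) {Ψ ψ : ℝ → ℝ}
    {K : ℝ≥0} (hΨ : LipschitzWith K Ψ) (hψ : ∀ t, HasDerivWithinAt Ψ (ψ t) (Set.Ioi t) t) :
    IsWeakGradient Ω (fun x => Ψ (u x)) (fun x => ψ (u x) • g x) := by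
  intro φ h1 h2 h3 v
  -- `Φ n` is the mean of `Ψ` over `[t, t + 1 / (n + 1)]`. It is `C¹`, and its derivative is a
  -- forward difference quotient of `Ψ`, bounded by `K` and convergent to `ψ` at every point.
  -- Convergence everywhere, not just almost everywhere, is what makes level sets of `u` over the
  -- kinks of `Ψ` harmless.
  set P : ℝ → ℝ := fun t => ∫ s in (0 : ℝ)..t, Ψ s
  have hP : ∀ t, HasDerivAt P (Ψ t) t := fun t =>
    intervalIntegral.integral_hasDerivAt_right (hΨ.continuous.intervalIntegrable _ _)
      (hΨ.continuous.stronglyMeasurableAtFilter _ _) hΨ.continuous.continuousAt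
  set Φ : ℕ → ℝ → ℝ := fun n t => ((n : ℝ) + 1) * (P (t + 1 / ((n : ℝ) + 1)) - P t) with hΦdef
  set Φ' : ℕ → ℝ → ℝ := fun n t => ((n : ℝ) + 1) * (Ψ (t + 1 / ((n : ℝ) + 1)) - Ψ t) with hΦ'def
  have hΦ : ∀ n t, HasDerivAt (Φ n) (Φ' n t) t := fun n t =>
    (((hP _).comp_add_const t _).sub (hP t)).const_mul _
  have hΦ'c : ∀ n, Continuous (Φ' n) := fun n => by
    have := hΨ.continuous
    fun_prop
  have hΦc : ∀ n, Continuous (Φ n) := fun n =>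
    continuous_iff_continuousAt.2 fun t => (hΦ n t).continuousAt
  have hK : ∀ n t, |Φ' n t| ≤ K := by
    intro n t
    have hn : (0 : ℝ) < (n : ℝ) + 1 := by positivity
    have := hΨ.dist_le_mul (t + 1 / ((n : ℝ) + 1)) t
    rw [Real.dist_eq, Real.dist_eq, add_sub_cancel_left,
      abs_of_pos (by positivity : (0 : ℝ) < 1 / ((n : ℝ) + 1))] at this
    rw [hΦ'def]
    simp only
    rw [abs_mul, abs_of_pos hn]
    calc _ ≤ ((n : ℝ) + 1) * (K * (1 / ((n : ℝ) + 1))) := by gcongr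
      _ = K := by field_simp
  have lΦ : ∀ t, Tendsto (fun n => Φ n t) atTop (𝓝 (Ψ t)) := fun t =>
    (hP t).hasDerivWithinAt.tendsto_nat_mul_sub
  have lΦ' : ∀ t, Tendsto (fun n => Φ' n t) atTop (𝓝 (ψ t)) := fun t =>
    (hψ t).tendsto_nat_mul_sub
  obtain ⟨B, hB⟩ : ∃ B, ∀ n, |Φ n 0| ≤ B := by
    obtain ⟨B, hB⟩ := (lΦ 0).abs.bddAbove_range
    exact ⟨B, fun n => hB ⟨n, rfl⟩⟩
  -- The bound is uniform in `n`: all `Φ n` are `K`-Lipschitz and their values at `0` converge.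
  have hΦb : ∀ n t, |Φ n t| ≤ B + K * |t| := by
    intro n t
    have hl : LipschitzWith K (Φ n) := by
      refine lipschitzWith_of_nnnorm_deriv_le (fun t => (hΦ n t).differentiableAt) fun t => ?_
      rw [(hΦ n t).deriv, ← NNReal.coe_le_coe]
      exact hK n t
    have := hl.dist_le_mul t 0
    rw [Real.dist_eq, Real.dist_eq, sub_zero] at this
    have h3 := abs_sub_abs_le_abs_sub (Φ n t) (Φ n 0)
    linarith [hB n]
  have hgv : MemLp (fun x => inner ℝ (g x) v) ∞ (volume.restrict Ω) := hg.inner_const v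
  obtain ⟨M, hM⟩ := ae_bound_indicator hΩ hu
  obtain ⟨M', hM'⟩ := ae_bound_indicator hΩ hgv
  replace hM := ae_restrict_of_ae (s := Ω) hM
  replace hM' := ae_restrict_of_ae (s := Ω) hM'
  have hmem := ae_restrict_mem (μ := (volume : Measure (RN N))) hΩ.measurableSet
  have hdc : Continuous fun x => fderiv ℝ φ x v :=
    (h1.continuous_fderiv (by simp)).clm_apply continuous_const
  have hdi : Integrable (fun x => |fderiv ℝ φ x v|) (volume.restrict Ω) :=
    ((hdc.integrable_of_hasCompactSupport (h2.fderiv_apply (𝕜 := ℝ) v)).mono_measure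
      Measure.restrict_le_self).abs
  have hφi : Integrable (fun x => |φ x|) (volume.restrict Ω) :=
    ((h1.continuous.integrable_of_hasCompactSupport h2).mono_measure
      Measure.restrict_le_self).abs
  have lim1 : Tendsto (fun n => ∫ x in Ω, Φ n (u x) * fderiv ℝ φ x v) atTop
      (𝓝 (∫ x in Ω, Ψ (u x) * fderiv ℝ φ x v)) := by
    refine tendsto_integral_of_dominated_convergence (fun x => (B + K * M) * |fderiv ℝ φ x v|)
      (fun n => ((hΦc n).comp_aestronglyMeasurable hu.1).mul hdc.aestronglyMeasurable)
      (hdi.const_mul _) (fun n => ?_) (.of_forall fun x => (lΦ _).mul_const _)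
    filter_upwards [hM, hmem] with x hx hxΩ
    rw [norm_mul]
    refine mul_le_mul_of_nonneg_right ((hΦb n _).trans ?_) (abs_nonneg _)
    rw [Set.indicator_of_mem hxΩ] at hx
    gcongr
  have lim2 : Tendsto (fun n => ∫ x in Ω, inner ℝ (Φ' n (u x) • g x) v * φ x) atTop
      (𝓝 (∫ x in Ω, inner ℝ (ψ (u x) • g x) v * φ x)) := by
    simp only [real_inner_smul_left]
    refine tendsto_integral_of_dominated_convergence (fun x => K * M' * |φ x|)
      (fun n => (((hΦ'c n).comp_aestronglyMeasurable hu.1).mul hgv.1).mul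
        h1.continuous.aestronglyMeasurable)
      (hφi.const_mul _) (fun n => ?_)
      (.of_forall fun x => ((lΦ' _).mul_const _).mul_const _)
    filter_upwards [hM', hmem] with x hx hxΩ
    rw [norm_mul, norm_mul]
    refine mul_le_mul_of_nonneg_right ?_ (abs_nonneg _)
    rw [Set.indicator_of_mem hxΩ] at hx
    exact mul_le_mul (hK n _) hx (abs_nonneg _) K.2
  exact tendsto_nhds_unique (lim1.congr fun n =>
    h.comp_of_hasDerivAt hΩ hb hu hg (hΦ n) (hΦ'c n) φ h1 h2 h3 v) lim2.neg

/-! ### The staircase function -/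

/-- The nondecreasing piecewise affine function with slope `1` on `[j, j + c]` and slope `0` on
`[j + c, j + 1]` for every integer `j`. -/
noncomputable def staircase (c t : ℝ) : ℝ := ⌊t⌋ * c + min (Int.fract t) c

/-- Both functions grow by `c` over each unit interval, so the difference depends only on the
fractional part and is a difference of two numbers in `[0, 1]`. -/
theorem abs_staircase_sub_le {c : ℝ} (h0 : 0 ≤ c) (h1 : c ≤ 1) (t : ℝ) :
    |staircase c t - c * t| ≤ 1 := by
  have hf := Int.floor_add_fract t
  have hf0 := Int.fract_nonneg t
  have hf1 := (Int.fract_lt_one t).le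
  have e : staircase c t - c * t = min (Int.fract t) c - c * Int.fract t := by
    have ht : c * t = c * (⌊t⌋ + Int.fract t) := by rw [hf]
    rw [staircase, ht]
    ring
  rw [e, abs_le]
  have := le_min hf0 h0
  have := min_le_right (Int.fract t) c
  constructor <;> nlinarith

theorem lipschitzWith_staircase {c : ℝ} (h0 : 0 ≤ c) (h1 : c ≤ 1) :
    LipschitzWith 1 (staircase c) := by
  have key : ∀ s t : ℝ, s ≤ t → staircase c s ≤ staircase c t ∧
      staircase c t - staircase c s ≤ t - s := by
    intro s t hst
    have hs := Int.floor_add_fract s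
    have ht := Int.floor_add_fract t
    have := Int.fract_nonneg s
    have := Int.fract_nonneg t
    have := Int.fract_lt_one s
    have := Int.fract_lt_one t
    unfold staircase
    rcases (Int.floor_mono hst).eq_or_lt with h | h
    · rw [h] at hs ⊢
      constructor
      · gcongr
        linarith
      · rcases min_cases (Int.fract s) c with hm | hm <;>
          rcases min_cases (Int.fract t) c with hm' | hm' <;> linarith
    · have h' : (⌊s⌋ : ℝ) + 1 ≤ ⌊t⌋ := by exact_mod_cast h
      constructor
      · have := min_le_right (Int.fract s) c
        have := le_min (Int.fract_nonneg t) h0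
        nlinarith
      · have : min (Int.fract t) c ≤ Int.fract t := min_le_left _ _
        -- This bounds from below what `s` has already climbed on its own step: the flat part that
        -- follows has length `1 - c`.
        have : Int.fract s + c - 1 ≤ min (Int.fract s) c := le_min (by linarith) (by linarith)
        nlinarith
  refine LipschitzWith.of_dist_le_mul fun s t => ?_
  rw [Real.dist_eq, Real.dist_eq, NNReal.coe_one, one_mul]
  rcases le_total s t with h | h
  · obtain ⟨a, b⟩ := key s t h
    rw [abs_sub_comm, abs_sub_comm s, abs_of_nonneg (by linarith), abs_of_nonneg (by linarith)]
    exact b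
  · obtain ⟨a, b⟩ := key t s h
    rw [abs_of_nonneg (by linarith), abs_of_nonneg (by linarith)]
    exact b

/-- Just to the right of `t` the floor is constant, so integers cause no trouble; at the kink `fract
t = c` the right slope is already `0`, hence the strict inequality. -/
theorem hasDerivWithinAt_staircase (c t : ℝ) :
    HasDerivWithinAt (staircase c) (if Int.fract t < c then 1 else 0) (Set.Ioi t) t := by
  have hf := Int.floor_add_fract t
  have hev : ∀ᶠ s in 𝓝[>] t, staircase c s = ⌊t⌋ * c + min (s - ⌊t⌋) c := by
    filter_upwards [Ioo_mem_nhdsGT (Int.lt_floor_add_one t)] with s hs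
    have : ⌊s⌋ = ⌊t⌋ := Int.floor_eq_iff.2 ⟨(Int.floor_le t).trans hs.1.le, hs.2⟩
    rw [staircase, Int.fract, this]
  refine HasDerivWithinAt.congr_of_eventuallyEq ?_ hev rfl
  split_ifs with h
  · have hlt : t - ⌊t⌋ < c := h
    have h1 : HasDerivWithinAt (fun s : ℝ => ⌊t⌋ * c + (s - ⌊t⌋)) 1 (Set.Ioi t) t :=
      ((hasDerivAt_id t).sub_const _).const_add _ |>.hasDerivWithinAt
    refine h1.congr_of_eventuallyEq ?_ (by rw [min_eq_left hlt.le])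
    filter_upwards [mem_nhdsWithin_of_mem_nhds
      (Iio_mem_nhds (show t < ⌊t⌋ + c by linarith))] with s hs
    rw [min_eq_left]
    have : s < ⌊t⌋ + c := hs
    linarith
  · have hle : c ≤ t - ⌊t⌋ := not_lt.1 h
    refine (hasDerivWithinAt_const t (Set.Ioi t) (⌊t⌋ * c + c)).congr_of_eventuallyEq ?_
      (by rw [min_eq_right hle])
    filter_upwards [self_mem_nhdsWithin] with s hs
    have : t < s := hs
    rw [min_eq_right (by linarith)]

/-! ### Fine staircases of Sobolev functions -/

/-- Composition with the staircase keeps the gradient in `{0, Du}` and changes `c u` by at most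
`1`. -/
theorem W1inf.exists_staircase {N : ℕ} {Ω : Set (RN N)} (hΩ : IsOpen Ω)
    (hb : Bornology.IsBounded Ω) (u : W1inf Ω) {c : ℝ} (h0 : 0 ≤ c) (h1 : c ≤ 1) :
    ∃ w : W1inf Ω, ‖w.1.1 - c • u.1.1‖ ≤ 1 ∧
      ∀ᵐ x ∂volume.restrict Ω, W1inf.grad w x = 0 ∨ W1inf.grad w x = W1inf.grad u x := by
  have hu := Lp.memLp u.1.1
  have hg := Lp.memLp u.1.2
  have hL := lipschitzWith_staircase h0 h1
  have hm : Measurable fun t : ℝ => if Int.fract t < c then (1 : ℝ) else 0 :=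
    Measurable.ite (measurable_fract measurableSet_Iio) measurable_const measurable_const
  have hbd : MemLp (fun x => staircase c (u.1.1 x) - c * u.1.1 x) ∞ (volume.restrict Ω) :=
    memLp_top_of_bound ((hL.continuous.comp_aestronglyMeasurable hu.1).sub (hu.1.const_mul c)) 1
      (.of_forall fun x => abs_staircase_sub_le h0 h1 _)
  have hw : MemLp (fun x => staircase c (u.1.1 x)) ∞ (volume.restrict Ω) := by
    have := hbd.add (hu.const_mul c)
    refine (memLp_congr_ae (.of_forall fun x => ?_)).1 this
    simp
  have hwg : MemLp (fun x => (if Int.fract (u.1.1 x) < c then (1 : ℝ) else 0) • u.1.2 x) ∞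
      (volume.restrict Ω) := by
    refine hg.of_le ((hm.comp_aemeasurable hu.1.aemeasurable).aestronglyMeasurable.smul hg.1)
      (.of_forall fun x => ?_)
    split_ifs <;> simp
  have hW : IsWeakGradient Ω u.1.1 u.1.2 := u.2
  refine ⟨⟨(hw.toLp _, hwg.toLp _), (hW.comp_of_hasDerivWithinAt_Ioi hΩ hb hu hg hL
    (hasDerivWithinAt_staircase c)).congr hw.coeFn_toLp hwg.coeFn_toLp⟩, ?_, ?_⟩
  · rw [Lp.norm_def, eLpNorm_exponent_top]
    refine ENNReal.toReal_le_of_le_ofReal zero_le_one (eLpNormEssSup_le_of_ae_bound ?_)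
    filter_upwards [Lp.coeFn_sub (hw.toLp _) (c • u.1.1), Lp.coeFn_smul c u.1.1,
      hw.coeFn_toLp] with x e1 e2 e3
    rw [e1, Pi.sub_apply, e2, e3]
    exact abs_staircase_sub_le h0 h1 _
  · filter_upwards [hwg.coeFn_toLp] with x e
    change (hwg.toLp _ : RN N → RN N) x = 0 ∨ (hwg.toLp _ : RN N → RN N) x = u.1.2 x
    rw [e]
    split_ifs <;> simp

/-- Apply the staircase to `(n + 1) u` and divide by `n + 1`: the error `1` becomes `1 / (n + 1)`,
while the scaling cancels in the gradient, which stays in `{0, Du}`. -/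
theorem W1inf.exists_seq_tendsto_smul {N : ℕ} {Ω : Set (RN N)} (hΩ : IsOpen Ω)
    (hb : Bornology.IsBounded Ω) (u : W1inf Ω) {c : ℝ} (h0 : 0 ≤ c) (h1 : c ≤ 1) :
    ∃ w : ℕ → W1inf Ω, Tendsto (fun n => (w n).1.1) atTop (𝓝 (c • u.1.1)) ∧
      ∀ n, ∀ᵐ x ∂volume.restrict Ω,
        W1inf.grad (w n) x = 0 ∨ W1inf.grad (w n) x = W1inf.grad u x := by
  have hpos : ∀ n : ℕ, (0 : ℝ) < (n : ℝ) + 1 := fun n => by positivity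
  choose w hw hwg using fun n : ℕ =>
    W1inf.exists_staircase hΩ hb (((n : ℝ) + 1) • u) h0 h1
  refine ⟨fun n => ((n : ℝ) + 1)⁻¹ • w n, ?_, fun n => ?_⟩
  · rw [tendsto_iff_norm_sub_tendsto_zero]
    refine squeeze_zero (fun _ => norm_nonneg _) (fun n => ?_)
      (tendsto_one_div_add_atTop_nhds_zero_nat (𝕜 := ℝ))
    have e : (((n : ℝ) + 1)⁻¹ • w n).1.1 - c • u.1.1 =
        ((n : ℝ) + 1)⁻¹ • ((w n).1.1 - c • (((n : ℝ) + 1) • u).1.1) := by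
      change ((n : ℝ) + 1)⁻¹ • (w n).1.1 - c • u.1.1 =
        ((n : ℝ) + 1)⁻¹ • ((w n).1.1 - c • ((n : ℝ) + 1) • u.1.1)
      rw [smul_sub, smul_comm c, inv_smul_smul₀ (hpos n).ne']
    rw [e, norm_smul, norm_inv, Real.norm_of_nonneg (hpos n).le, one_div]
    exact mul_le_of_le_one_right (inv_nonneg.2 (hpos n).le) (hw n)
  · filter_upwards [hwg n, Lp.coeFn_smul ((n : ℝ) + 1)⁻¹ (w n).1.2,
      Lp.coeFn_smul ((n : ℝ) + 1) u.1.2] with x hx e1 e2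
    change (((n : ℝ) + 1)⁻¹ • (w n).1.2 : Lp (RN N) ⊤ _) x = 0 ∨
      (((n : ℝ) + 1)⁻¹ • (w n).1.2 : Lp (RN N) ⊤ _) x = u.1.2 x
    change (w n).1.2 x = 0 ∨ (w n).1.2 x = (((n : ℝ) + 1) • u.1.2 : Lp (RN N) ⊤ _) x at hx
    rw [e1, Pi.smul_apply]
    rw [e2, Pi.smul_apply] at hx
    rcases hx with hx | hx
    · left; rw [hx, smul_zero]
    · right; rw [hx, inv_smul_smul₀ (hpos n).ne']

/-! ### Density of test functions and weak* convergence -/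

open scoped Manifold in
/-- Indicators of measurable subsets of a bounded open set are `L¹` limits of test functions. -/
theorem exists_contDiff_integral_abs_indicator_sub_le {N : ℕ} {Ω : Set (RN N)} (hΩ : IsOpen Ω)
    (hb : Bornology.IsBounded Ω) {s : Set (RN N)} (hs : MeasurableSet s) {ε : ℝ} (hε : 0 < ε) :
    ∃ φ : RN N → ℝ, ContDiff ℝ ∞ φ ∧ HasCompactSupport φ ∧ tsupport φ ⊆ Ω ∧
      ∫ x in Ω, |s.indicator 1 x - φ x| ≤ ε := by
  have hfin : volume Ω < ⊤ := hb.measure_lt_top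
  have : IsFiniteMeasure (volume.restrict Ω) := ⟨by simpa using hfin⟩
  have hsΩ : MeasurableSet (s ∩ Ω) := hs.inter hΩ.measurableSet
  have hε' : ENNReal.ofReal (ε / 2) ≠ 0 := by simpa using hε
  -- Compact `K` inside `s ∩ Ω` and open `V` around `K`, each with defect at most `ε / 2`. With `φ =
  -- 1` on `K` and `φ = 0` off `V`, the error on `Ω` is bounded by the indicators of `(s ∩ Ω) \ K`
  -- and `V \ K`.
  obtain ⟨K, hKs, hK, hKε⟩ := hsΩ.exists_isCompact_sdiff_lt (μ := volume)
    ((measure_mono Set.inter_subset_right).trans_lt hfin).ne hε'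
  obtain ⟨V, hKV, hV, hVε⟩ := hK.exists_isOpen_lt_add (μ := volume) hε'
  obtain ⟨L, hL, hKL, hLU⟩ := exists_compact_between hK (hV.inter hΩ)
    (Set.subset_inter hKV (hKs.trans Set.inter_subset_right))
  obtain ⟨φ, hφ, hφr, hφs, hφ1⟩ := exists_contMDiff_support_eq_eq_one_iff (n := ⊤) 𝓘(ℝ, RN N)
    isOpen_interior hK.isClosed hKL
  have htL : tsupport φ ⊆ L :=
    closure_minimal (hφs.le.trans interior_subset) hL.isClosed
  have hφ' : ContDiff ℝ ∞ φ := hφ.contDiff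
  refine ⟨φ, hφ', HasCompactSupport.of_support_subset_isCompact hL
    (hφs.le.trans interior_subset), htL.trans (hLU.trans Set.inter_subset_right), ?_⟩
  have hφ0 : ∀ x, 0 ≤ φ x := fun x => (hφr ⟨x, rfl⟩).1
  have hφle : ∀ x, φ x ≤ 1 := fun x => (hφr ⟨x, rfl⟩).2
  have hVK : MeasurableSet (V \ K) := hV.measurableSet.diff hK.measurableSet
  have hsK : MeasurableSet ((s ∩ Ω) \ K) := hsΩ.diff hK.measurableSet
  have hVKε : volume (V \ K) ≤ ENNReal.ofReal (ε / 2) := by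
    rw [measure_sdiff hKV hK.measurableSet.nullMeasurableSet hK.measure_lt_top.ne]
    exact tsub_le_iff_left.2 hVε.le
  have hreal : ∀ t, MeasurableSet t → volume t ≤ ENNReal.ofReal (ε / 2) →
      Integrable (t.indicator (1 : RN N → ℝ)) (volume.restrict Ω) ∧
        ∫ x in Ω, t.indicator (1 : RN N → ℝ) x ≤ ε / 2 := by
    intro t ht hle
    refine ⟨(integrable_const (1 : ℝ)).indicator ht, ?_⟩
    rw [integral_indicator_one ht]
    refine ENNReal.toReal_le_of_le_ofReal (by positivity) ?_
    exact (Measure.restrict_apply_le _ _).trans hle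
  obtain ⟨i1, b1⟩ := hreal _ hsK hKε.le
  obtain ⟨i2, b2⟩ := hreal _ hVK hVKε
  calc ∫ x in Ω, |s.indicator 1 x - φ x|
      ≤ ∫ x in Ω, (((s ∩ Ω) \ K).indicator 1 x + (V \ K).indicator 1 x) := by
        refine integral_mono_of_nonneg (.of_forall fun x => abs_nonneg _) (i1.add i2) ?_
        filter_upwards [ae_restrict_mem hΩ.measurableSet] with x hx
        by_cases hxK : x ∈ K
        · have h1 : φ x = 1 := (hφ1 x).1 hxK
          have h2 : x ∈ s := (hKs hxK).1
          simp [h1, h2, hxK]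
        · have hv : φ x ≤ (V \ K).indicator 1 x := by
            by_cases hxV : x ∈ V
            · simpa [hxV, hxK] using hφle x
            · have : φ x = 0 := by
                by_contra hne
                have : x ∈ interior L := hφs ▸ (Function.mem_support.2 hne)
                exact hxV (hLU (interior_subset this)).1
              simp [this, hxV]
          have hv0 : 0 ≤ (V \ K).indicator (1 : RN N → ℝ) x :=
            Set.indicator_nonneg (fun _ _ => zero_le_one) x
          by_cases hxs : x ∈ s
          · simp only [hxs, hx, hxK, Set.indicator_of_mem, Set.mem_sdiff, Set.mem_inter_iff,
              Pi.one_apply, and_self, not_false_eq_true]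
            rw [abs_of_nonneg (by linarith [hφle x])]
            linarith [hφ0 x]
          · simpa [hxs, abs_of_nonneg (hφ0 x)] using hv
    _ ≤ ε := by
        rw [integral_add i1 i2]
        linarith

/-- A bounded sequence in `L^∞(Ω; ℝ^N)` that converges when tested against `C_c^∞(Ω)` converges
when tested against `L¹(Ω; ℝ^N)`. -/
theorem tendsto_integral_inner_of_contDiff {N : ℕ} {Ω : Set (RN N)} (hΩ : IsOpen Ω)
    (hb : Bornology.IsBounded Ω) {G : ℕ → RN N → RN N} {G₀ : RN N → RN N} {C : ℝ}
    (hG : ∀ n, AEStronglyMeasurable (G n) (volume.restrict Ω))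
    (hG₀ : AEStronglyMeasurable G₀ (volume.restrict Ω))
    (hC : ∀ n, ∀ᵐ x ∂volume.restrict Ω, ‖G n x‖ ≤ C)
    (hC₀ : ∀ᵐ x ∂volume.restrict Ω, ‖G₀ x‖ ≤ C)
    (h : ∀ φ : RN N → ℝ, ContDiff ℝ ∞ φ → HasCompactSupport φ → tsupport φ ⊆ Ω → ∀ v : RN N,
      Tendsto (fun n => ∫ x in Ω, inner ℝ (G n x) v * φ x) atTop
        (𝓝 (∫ x in Ω, inner ℝ (G₀ x) v * φ x)))
    {H : RN N → RN N} (hH : Integrable H (volume.restrict Ω)) :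
    Tendsto (fun n => ∫ x in Ω, inner ℝ (G n x) (H x)) atTop
      (𝓝 (∫ x in Ω, inner ℝ (G₀ x) (H x))) := by
  have : IsFiniteMeasure (volume.restrict Ω) := ⟨by simpa using hb.measure_lt_top⟩
  wlog hC0 : 0 < C generalizing C
  · exact this (C := |C| + 1) (fun n => (hC n).mono fun x hx => by linarith [le_abs_self C])
      (hC₀.mono fun x hx => by linarith [le_abs_self C]) (by positivity)
  have hint : ∀ {A : RN N → RN N}, AEStronglyMeasurable A (volume.restrict Ω) →
      (∀ᵐ x ∂volume.restrict Ω, ‖A x‖ ≤ C) → ∀ {H : RN N → RN N},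
      Integrable H (volume.restrict Ω) →
      Integrable (fun x => inner ℝ (A x) (H x)) (volume.restrict Ω) := by
    intro A hA hAC H hH
    refine (hH.norm.const_mul C).mono' (hA.inner hH.1) ?_
    filter_upwards [hAC] with x hx
    exact (norm_inner_le_norm _ _).trans (by gcongr)
  have hdiff : ∀ {A : RN N → RN N}, AEStronglyMeasurable A (volume.restrict Ω) →
      (∀ᵐ x ∂volume.restrict Ω, ‖A x‖ ≤ C) → ∀ {H H' : RN N → RN N},
      Integrable H (volume.restrict Ω) → Integrable H' (volume.restrict Ω) →
      |(∫ x in Ω, inner ℝ (A x) (H x)) - ∫ x in Ω, inner ℝ (A x) (H' x)| ≤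
        C * ∫ x in Ω, ‖H x - H' x‖ := by
    intro A hA hAC H H' hH hH'
    rw [← integral_sub (hint hA hAC hH) (hint hA hAC hH'), ← integral_const_mul,
      ← Real.norm_eq_abs]
    refine norm_integral_le_of_norm_le ((hH.sub hH').norm.const_mul C) ?_
    filter_upwards [hAC] with x hx
    rw [← inner_sub_right]
    exact (norm_inner_le_norm _ _).trans (by gcongr)
  -- The set of good `H` is closed in `L¹`, by the uniform bound `C`. This serves both for
  -- indicators, approximated by `φ • c`, and for the closedness step of the induction.
  have happrox : ∀ {H : RN N → RN N}, Integrable H (volume.restrict Ω) →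
      (∀ ε > 0, ∃ H' : RN N → RN N, Integrable H' (volume.restrict Ω) ∧
        ∫ x in Ω, ‖H x - H' x‖ ≤ ε ∧
        Tendsto (fun n => ∫ x in Ω, inner ℝ (G n x) (H' x)) atTop
          (𝓝 (∫ x in Ω, inner ℝ (G₀ x) (H' x)))) →
      Tendsto (fun n => ∫ x in Ω, inner ℝ (G n x) (H x)) atTop
        (𝓝 (∫ x in Ω, inner ℝ (G₀ x) (H x))) := by
    intro H hH hex
    rw [Metric.tendsto_atTop]
    intro ε hε
    obtain ⟨H', hH', hle, ht⟩ := hex (ε / (4 * C)) (by positivity)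
    obtain ⟨n₀, hn₀⟩ := (Metric.tendsto_atTop.1 ht) (ε / 2) (by positivity)
    refine ⟨n₀, fun n hn => ?_⟩
    have h1 := hn₀ n hn
    have h2 := hdiff (hG n) (hC n) hH hH'
    have h3 := hdiff hG₀ hC₀ hH hH'
    have h4 : C * ∫ x in Ω, ‖H x - H' x‖ ≤ ε / 4 := by
      calc _ ≤ C * (ε / (4 * C)) := by gcongr
        _ = ε / 4 := by field_simp
    rw [Real.dist_eq] at h1 ⊢
    rw [abs_lt] at h1 ⊢
    have h2' := abs_le.1 (h2.trans h4)
    have h3' := abs_le.1 (h3.trans h4)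
    constructor <;> linarith [h1.1, h1.2, h2'.1, h2'.2, h3'.1, h3'.2]
  refine Integrable.induction (μ := volume.restrict Ω)
    (fun H => Tendsto (fun n => ∫ x in Ω, inner ℝ (G n x) (H x)) atTop
      (𝓝 (∫ x in Ω, inner ℝ (G₀ x) (H x)))) ?_ ?_ ?_ ?_ hH
  · intro c s hs _
    have hsi : Integrable (s.indicator fun _ => c) (volume.restrict Ω) :=
      (integrable_const c).indicator hs
    refine happrox hsi fun ε hε => ?_
    obtain ⟨φ, h1, h2, h3, h4⟩ := exists_contDiff_integral_abs_indicator_sub_le hΩ hb hs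
      (div_pos hε (by positivity : 0 < ‖c‖ + 1))
    have hφi : Integrable φ (volume.restrict Ω) :=
      (h1.continuous.integrable_of_hasCompactSupport h2).mono_measure Measure.restrict_le_self
    refine ⟨fun x => φ x • c, hφi.smul_const c, ?_, ?_⟩
    · have e : ∀ x, ‖s.indicator (fun _ => c) x - φ x • c‖ =
          |s.indicator 1 x - φ x| * ‖c‖ := by
        intro x
        rw [← Real.norm_eq_abs, ← norm_smul, sub_smul]
        by_cases hx : x ∈ s <;> simp [hx]
      simp only [e]
      rw [integral_mul_const]
      calc _ ≤ ε / (‖c‖ + 1) * ‖c‖ := by gcongr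
        _ ≤ ε := by
          rw [div_mul_eq_mul_div, div_le_iff₀ (by positivity)]
          nlinarith [norm_nonneg c]
    · simpa only [real_inner_smul_right, mul_comm] using h φ h1 h2 h3 c
  · intro f g _ hf hg h1 h2
    simp only [Pi.add_apply, inner_add_right]
    rw [integral_add (hint hG₀ hC₀ hf) (hint hG₀ hC₀ hg)]
    refine (h1.add h2).congr fun n => ?_
    rw [integral_add (hint (hG n) (hC n) hf) (hint (hG n) (hC n) hg)]
  · refine isClosed_of_closure_subset fun f hf => ?_
    refine happrox (L1.integrable_coeFn f) fun ε hε => ?_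
    obtain ⟨g, hg, hfg⟩ := Metric.mem_closure_iff.1 hf ε hε
    refine ⟨g, L1.integrable_coeFn g, ?_, hg⟩
    rw [L1.dist_eq_integral_dist] at hfg
    simpa only [dist_eq_norm] using hfg.le
  · intro f g hfg _ hf
    refine Tendsto.congr (f₁ := fun n => ∫ x in Ω, inner ℝ (G n x) (f x))
      (fun n => integral_congr_ae ?_) ?_
    · filter_upwards [hfg] with x hx
      rw [hx]
    · convert hf using 2
      refine integral_congr_ae ?_
      filter_upwards [hfg] with x hx
      rw [hx]

theorem ae_norm_le_Lp_top {N : ℕ} {E : Type*} [NormedAddCommGroup E] {Ω : Set (RN N)}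
    (u : Lp E ∞ (volume.restrict Ω)) : ∀ᵐ x ∂volume.restrict Ω, ‖u x‖ ≤ ‖u‖ := by
  have hfin : eLpNormEssSup u (volume.restrict Ω) ≠ ⊤ := by
    simpa [eLpNorm_exponent_top] using (Lp.eLpNorm_lt_top u).ne
  rw [Lp.norm_def, eLpNorm_exponent_top]
  filter_upwards [enorm_ae_le_eLpNormEssSup u (volume.restrict Ω)] with x hx
  simpa using ENNReal.toReal_mono hfin hx

theorem integrable_Lp_top_mul {N : ℕ} {Ω : Set (RN N)} (u : Lp ℝ ∞ (volume.restrict Ω))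
    {h : RN N → ℝ} (hh : Integrable h (volume.restrict Ω)) :
    Integrable (fun x => u x * h x) (volume.restrict Ω) := by
  refine (hh.norm.const_mul ‖u‖).mono' ((Lp.aestronglyMeasurable u).mul hh.1) ?_
  filter_upwards [ae_norm_le_Lp_top u] with x hx
  rw [norm_mul]
  gcongr

theorem integrable_Lp_top_inner {N : ℕ} {Ω : Set (RN N)} (g : Lp (RN N) ∞ (volume.restrict Ω))
    {H : RN N → RN N} (hH : Integrable H (volume.restrict Ω)) :
    Integrable (fun x => inner ℝ (g x) (H x)) (volume.restrict Ω) := by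
  refine (hH.norm.const_mul ‖g‖).mono' ((Lp.aestronglyMeasurable g).inner hH.1) ?_
  filter_upwards [ae_norm_le_Lp_top g] with x hx
  exact (norm_inner_le_norm _ _).trans (by gcongr)

theorem tendsto_integral_mul_of_tendsto_Lp_top {N : ℕ} {Ω : Set (RN N)}
    {w : ℕ → Lp ℝ ∞ (volume.restrict Ω)} {v : Lp ℝ ∞ (volume.restrict Ω)}
    (hw : Tendsto w atTop (𝓝 v)) {h : RN N → ℝ} (hh : Integrable h (volume.restrict Ω)) :
    Tendsto (fun n => ∫ x in Ω, w n x * h x) atTop (𝓝 (∫ x in Ω, v x * h x)) := by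
  rw [tendsto_iff_norm_sub_tendsto_zero] at hw ⊢
  refine squeeze_zero (fun _ => norm_nonneg _) (fun n => ?_)
    (by simpa using hw.mul_const (∫ x in Ω, ‖h x‖))
  rw [← integral_sub (integrable_Lp_top_mul _ hh) (integrable_Lp_top_mul _ hh),
    ← integral_const_mul]
  refine norm_integral_le_of_norm_le (hh.norm.const_mul _) ?_
  filter_upwards [ae_norm_le_Lp_top (w n - v), Lp.coeFn_sub (w n) v] with x hx e
  rw [e, Pi.sub_apply] at hx
  rw [← sub_mul, norm_mul]
  exact mul_le_mul_of_nonneg_right hx (norm_nonneg _)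

theorem W1inf.tendsto_tauWeakStar_iff {N : ℕ} {Ω : Set (RN N)} {ι : Type*} {l : Filter ι}
    {w : ι → W1inf Ω} {v : W1inf Ω} :
    Tendsto w l (@nhds _ (tauWeakStar Ω) v) ↔
      (∀ h : Lp ℝ 1 (volume.restrict Ω), Tendsto (fun n => ∫ x in Ω, (w n).1.1 x * h x) l
        (𝓝 (∫ x in Ω, v.1.1 x * h x))) ∧
      ∀ H : Lp (RN N) 1 (volume.restrict Ω),
        Tendsto (fun n => ∫ x in Ω, inner ℝ (W1inf.grad (w n) x) (H x)) l
          (𝓝 (∫ x in Ω, inner ℝ (W1inf.grad v x) (H x))) := by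
  have hinf : ∀ {ι' : Type} (e : ι' → W1inf Ω → ℝ),
      Tendsto w l (@nhds _ (⨅ i, TopologicalSpace.induced (e i) inferInstance) v) ↔
        ∀ i, Tendsto (fun n => e i (w n)) l (𝓝 (e i v)) := fun e => by
    rw [@nhds_iInf, tendsto_iInf]
    refine forall_congr' fun i => ?_
    rw [@nhds_induced, tendsto_comap_iff]
    rfl
  rw [tauWeakStar, nhds_inf (t₁ := ⨅ h : Lp ℝ 1 (volume.restrict Ω), _)
    (t₂ := ⨅ H : Lp (RN N) 1 (volume.restrict Ω), _), tendsto_inf]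
  exact and_congr (hinf _) (hinf _)

/-- Uniform convergence with bounded gradients implies weak* convergence in `W^{1,∞}(Ω)`. -/
theorem W1inf.tendsto_tauWeakStar {N : ℕ} {Ω : Set (RN N)} (hΩ : IsOpen Ω)
    (hb : Bornology.IsBounded Ω) {w : ℕ → W1inf Ω} {v : W1inf Ω}
    (hw : Tendsto (fun n => (w n).1.1) atTop (𝓝 v.1.1)) {C : ℝ}
    (hC : ∀ n, ∀ᵐ x ∂volume.restrict Ω, ‖W1inf.grad (w n) x‖ ≤ C) :
    Tendsto w atTop (@nhds _ (tauWeakStar Ω) v) := by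
  refine W1inf.tendsto_tauWeakStar_iff.2 ⟨fun h =>
    tendsto_integral_mul_of_tendsto_Lp_top hw (L1.integrable_coeFn h), fun H => ?_⟩
  refine tendsto_integral_inner_of_contDiff hΩ hb (C := max C ‖W1inf.grad v‖)
    (fun n => Lp.aestronglyMeasurable _) (Lp.aestronglyMeasurable _)
    (fun n => (hC n).mono fun x hx => hx.trans (le_max_left _ _))
    ((ae_norm_le_Lp_top _).mono fun x hx => hx.trans (le_max_right _ _)) ?_
    (L1.integrable_coeFn H)
  intro φ h1 h2 h3 e
  have hd : Integrable (fun x => fderiv ℝ φ x e) (volume.restrict Ω) :=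
    ((((h1.continuous_fderiv (by simp)).clm_apply continuous_const
      ).integrable_of_hasCompactSupport (h2.fderiv_apply (𝕜 := ℝ) e))).mono_measure
      Measure.restrict_le_self
  -- Against a test function the derivative moves onto `φ`, so uniform convergence of the functions
  -- alone suffices.
  have key : ∀ u : W1inf Ω, ∫ x in Ω, inner ℝ (W1inf.grad u x) e * φ x =
      -∫ x in Ω, u.1.1 x * fderiv ℝ φ x e := fun u => by
    have hu : IsWeakGradient Ω u.1.1 u.1.2 := u.2
    rw [hu φ h1 h2 h3 e, neg_neg]
    rfl
  simp only [key]
  exact (tendsto_integral_mul_of_tendsto_Lp_top hw hd).neg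

/-! ### Continuity of affine maps in the three topologies -/

theorem W1inf.coeFn_smul_add {N : ℕ} {Ω : Set (RN N)} (a : ℝ) (u b : W1inf Ω) :
    (∀ᵐ x ∂volume.restrict Ω, (a • u + b).1.1 x = a * u.1.1 x + b.1.1 x) ∧
      ∀ᵐ x ∂volume.restrict Ω,
        W1inf.grad (a • u + b) x = a • W1inf.grad u x + W1inf.grad b x := by
  constructor
  · filter_upwards [Lp.coeFn_add (a • u.1.1) b.1.1, Lp.coeFn_smul a u.1.1] with x e1 e2
    change (a • u.1.1 + b.1.1 : Lp ℝ ⊤ _) x = _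
    rw [e1, Pi.add_apply, e2, Pi.smul_apply, smul_eq_mul]
  · filter_upwards [Lp.coeFn_add (a • u.1.2) b.1.2, Lp.coeFn_smul a u.1.2] with x e1 e2
    change (a • u.1.2 + b.1.2 : Lp (RN N) ⊤ _) x = _
    rw [e1, Pi.add_apply, e2, Pi.smul_apply]
    rfl

theorem continuous_smul_add_tauUniform {N : ℕ} {Ω : Set (RN N)} (a : ℝ) (b : W1inf Ω) :
    Continuous[tauUniform Ω, tauUniform Ω] fun u => a • u + b := by
  refine continuous_induced_rng.2 ?_
  have : Continuous[tauUniform Ω, _] fun u : W1inf Ω => u.1.1 := continuous_induced_dom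
  have h : Continuous fun g : Lp ℝ ∞ (volume.restrict Ω) => a • g + b.1.1 := by fun_prop
  have hc := @Continuous.comp _ _ _ (tauUniform Ω) _ _ _ _ h this
  exact hc

theorem W1inf.integral_smul_add_mul {N : ℕ} {Ω : Set (RN N)} (a : ℝ) (u b : W1inf Ω)
    (h : Lp ℝ 1 (volume.restrict Ω)) :
    ∫ x in Ω, (a • u + b).1.1 x * h x =
      a * (∫ x in Ω, u.1.1 x * h x) + ∫ x in Ω, b.1.1 x * h x := by
  have hh := L1.integrable_coeFn h
  rw [← integral_const_mul, ← integral_add ((integrable_Lp_top_mul u.1.1 hh).const_mul a)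
    (integrable_Lp_top_mul b.1.1 hh)]
  refine integral_congr_ae ?_
  filter_upwards [(W1inf.coeFn_smul_add a u b).1] with x e
  exact (congrArg (· * h x) e).trans (by ring)

theorem W1inf.integral_inner_grad_smul_add {N : ℕ} {Ω : Set (RN N)} (a : ℝ) (u b : W1inf Ω)
    (H : Lp (RN N) 1 (volume.restrict Ω)) :
    ∫ x in Ω, inner ℝ (W1inf.grad (a • u + b) x) (H x) =
      a * (∫ x in Ω, inner ℝ (W1inf.grad u x) (H x)) +
        ∫ x in Ω, inner ℝ (W1inf.grad b x) (H x) := by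
  have hH := L1.integrable_coeFn H
  rw [← integral_const_mul, ← integral_add
    ((integrable_Lp_top_inner (W1inf.grad u) hH).const_mul a)
    (integrable_Lp_top_inner (W1inf.grad b) hH)]
  refine integral_congr_ae ?_
  filter_upwards [(W1inf.coeFn_smul_add a u b).2] with x e
  exact (congrArg (inner ℝ · (H x)) e).trans (by rw [inner_add_left, real_inner_smul_left])

theorem continuous_smul_add_tauWeakStar {N : ℕ} {Ω : Set (RN N)} (a : ℝ) (b : W1inf Ω) :
    Continuous[tauWeakStar Ω, tauWeakStar Ω] fun u => a • u + b := by
  refine (@continuous_iff_continuousAt _ _ (tauWeakStar Ω) (tauWeakStar Ω) _).2 fun v =>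
    W1inf.tendsto_tauWeakStar_iff.2 ?_
  obtain ⟨h1, h2⟩ :=
    W1inf.tendsto_tauWeakStar_iff.1 (@tendsto_id _ (@nhds _ (tauWeakStar Ω) v))
  refine ⟨fun h => ?_, fun H => ?_⟩
  · rw [W1inf.integral_smul_add_mul]
    exact (((h1 h).const_mul a).add_const _).congr fun u =>
      (W1inf.integral_smul_add_mul a u b h).symm
  · rw [W1inf.integral_inner_grad_smul_add]
    exact (((h2 H).const_mul a).add_const _).congr fun u =>
      (W1inf.integral_inner_grad_smul_add a u b H).symm

/-- Preimages of sequentially closed sets under a continuous map are sequentially closed. -/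
theorem continuous_seqTopology {X : Type*} {τ : TopologicalSpace X} {T : X → X}
    (hT : Continuous[τ, τ] T) : Continuous[seqTopology τ, seqTopology τ] T := by
  refine (@continuous_iff_isClosed _ _ (seqTopology τ) (seqTopology τ) T).2 fun s hs => ?_
  have hs' := (isClosed_seqTopology_iff τ s).1 hs
  exact (isClosed_seqTopology_iff τ _).2 fun x p hx hp => hs' hx ((hT.tendsto p).comp hp)

theorem mem_closure_seqTopology {X : Type*} {τ : TopologicalSpace X} {s : Set X} {x : ℕ → X}
    {p : X} (hx : ∀ n, x n ∈ s) (hp : Tendsto x atTop (𝓝 p)) : p ∈ closure[seqTopology τ] s := by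
  have hcl : IsClosed[seqTopology τ] (closure[seqTopology τ] s) :=
    @isClosed_closure _ (seqTopology τ) s
  exact (isClosed_seqTopology_iff τ _).1 hcl
    (fun n => @subset_closure _ (seqTopology τ) s _ (hx n)) hp

/-! ### Envelopes and closures of sublevel sets -/

/-- Each lower semicontinuous minorant has closed sublevel sets containing those of `F`. -/
theorem relaxation_le_of_mem_closure {X : Type*} [τ : TopologicalSpace X] {F : X → EReal}
    {c : EReal} {x : X} (hx : x ∈ closure {y | F y ≤ c}) : relaxation τ F x ≤ c := by
  rw [relaxation, sSup_apply]
  refine iSup_le fun ⟨G, hG, hGF⟩ => ?_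
  have hcl : IsClosed {y | G y ≤ c} := hG.isClosed_preimage c
  exact closure_minimal (fun y hy => (hGF y).trans hy) hcl hx

theorem mem_closure_of_relaxation_lt {X : Type*} [τ : TopologicalSpace X] {F : X → EReal}
    {c : EReal} {x : X} (hx : relaxation τ F x < c) : x ∈ closure {y | F y ≤ c} := by
  classical
  by_contra hn
  -- The competitor is `⊥` on the closed set and `c` off it: lower semicontinuous, below `F`, and
  -- equal to `c` at `x` if `x` is outside the closure.
  set G : X → EReal := fun y => if y ∈ closure {y | F y ≤ c} then ⊥ else c with hG
  have hlsc : LowerSemicontinuous G := by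
    intro y a ha
    by_cases hy : y ∈ closure {y | F y ≤ c}
    · simp [hG, hy] at ha
    · filter_upwards [isClosed_closure.isOpen_compl.mem_nhds hy] with z hz
      have hz' : z ∉ closure {y | F y ≤ c} := hz
      simpa [hG, hy, hz'] using ha
  have hle : G ≤ F := by
    intro y
    by_cases hy : y ∈ closure {y | F y ≤ c}
    · simp [hG, hy]
    · have : c ≤ F y := le_of_lt (not_le.1 fun h => hy (subset_closure h))
      simpa [hG, hy] using this
  have : G x ≤ relaxation τ F x :=
    (le_sSup (show G ∈ {G | LowerSemicontinuous G ∧ G ≤ F} from ⟨hlsc, hle⟩) :) x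
  simp only [hG, hn, if_false] at this
  exact absurd hx (not_lt.2 this)

/-- If convex combinations of points of each sublevel set lie in its closure and affine maps
`x ↦ a x + b` are continuous, then the lower semicontinuous envelope is level convex. -/
theorem levelConvex_relaxation {X : Type*} [AddCommGroup X] [Module ℝ X]
    [τ : TopologicalSpace X] {F : X → EReal}
    (hcont : ∀ (a : ℝ) (b : X), Continuous fun x : X => a • x + b)
    (hF : ∀ (c : EReal) (θ : ℝ), 0 < θ → θ < 1 → ∀ x₁ x₂ : X, F x₁ ≤ c → F x₂ ≤ c →
      θ • x₁ + (1 - θ) • x₂ ∈ closure {y | F y ≤ c}) :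
    LevelConvex (relaxation τ F) := by
  intro θ h0 h1 x₁ x₂
  refine le_of_forall_gt_imp_ge_of_dense fun c hc => ?_
  have m₁ := mem_closure_of_relaxation_lt ((le_max_left _ _).trans_lt hc)
  have m₂ := mem_closure_of_relaxation_lt ((le_max_right _ _).trans_lt hc)
  refine relaxation_le_of_mem_closure ?_
  -- One variable at a time: with `y₁` fixed in the sublevel set, pass to the closure in the second
  -- point, then in the first. Joint continuity of addition is thus avoided.
  have step : ∀ y₁, F y₁ ≤ c → θ • y₁ + (1 - θ) • x₂ ∈ closure {y | F y ≤ c} := by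
    intro y₁ hy₁
    have hcl : IsClosed ((fun x : X => (1 - θ) • x + θ • y₁) ⁻¹' closure {y | F y ≤ c}) :=
      isClosed_closure.preimage (hcont _ _)
    have := closure_minimal (s := {y | F y ≤ c}) (fun y₂ hy₂ => by
      simpa only [Set.mem_preimage, add_comm] using hF c θ h0 h1 y₁ y₂ hy₁ hy₂) hcl m₂
    simpa only [Set.mem_preimage, add_comm] using this
  exact closure_minimal (s := {y | F y ≤ c}) step (isClosed_closure.preimage (hcont _ _)) m₁

/-! ### Level convexity of the relaxed supremal functionals -/

/-- Convex combinations in a sublevel set of a supremal functional are limits, uniformly and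
weakly*, of sequences in that sublevel set. -/
theorem exists_seq_supremalFunctional_le {N : ℕ} {Ω : Set (RN N)} (hΩ : IsOpen Ω)
    (hb : Bornology.IsBounded Ω) (f : RN N → RN N → EReal) {c : EReal} {θ : ℝ} (h0 : 0 ≤ θ)
    (h1 : θ ≤ 1) {u₁ u₂ : W1inf Ω} (hu₁ : supremalFunctional Ω f u₁ ≤ c)
    (hu₂ : supremalFunctional Ω f u₂ ≤ c) :
    ∃ w : ℕ → W1inf Ω, (∀ n, supremalFunctional Ω f (w n) ≤ c) ∧
      Tendsto w atTop (@nhds _ (tauUniform Ω) (θ • u₁ + (1 - θ) • u₂)) ∧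
      Tendsto w atTop (@nhds _ (tauWeakStar Ω) (θ • u₁ + (1 - θ) • u₂)) := by
  -- The difference `u₁ - u₂` is written in the form `a • u + b`, so that `W1inf.coeFn_smul_add`
  -- gives its gradient; the same holds for `1 • z n + u₂`.
  obtain ⟨z, hz, hzg⟩ := W1inf.exists_seq_tendsto_smul hΩ hb ((-1 : ℝ) • u₂ + u₁) h0 h1
  have hgrad : ∀ n, ∀ᵐ x ∂volume.restrict Ω,
      W1inf.grad ((1 : ℝ) • z n + u₂) x = W1inf.grad u₁ x ∨
        W1inf.grad ((1 : ℝ) • z n + u₂) x = W1inf.grad u₂ x := by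
    intro n
    filter_upwards [hzg n, (W1inf.coeFn_smul_add 1 (z n) u₂).2,
      (W1inf.coeFn_smul_add (-1) u₂ u₁).2] with x hx e1 e2
    rw [e1]
    rw [e2] at hx
    rcases hx with hx | hx <;> rw [hx]
    · right; simp
    · left; simp
  have hlim : Tendsto (fun n => ((1 : ℝ) • z n + u₂).1.1) atTop
      (𝓝 (θ • u₁ + (1 - θ) • u₂).1.1) := by
    have e : (θ • u₁ + (1 - θ) • u₂).1.1 = (1 : ℝ) • θ • ((-1 : ℝ) • u₂ + u₁).1.1 + u₂.1.1 := by
      change θ • u₁.1.1 + (1 - θ) • u₂.1.1 =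
        (1 : ℝ) • θ • ((-1 : ℝ) • u₂.1.1 + u₁.1.1) + u₂.1.1
      module
    rw [e]
    exact (hz.const_smul (1 : ℝ)).add_const _
  refine ⟨fun n => (1 : ℝ) • z n + u₂, fun n => ?_, ?_, ?_⟩
  · refine essSup_le_of_ae_le c ?_
    have a1 := ae_le_essSup (f := fun x => f x (W1inf.grad u₁ x)) (μ := volume.restrict Ω)
    have a2 := ae_le_essSup (f := fun x => f x (W1inf.grad u₂ x)) (μ := volume.restrict Ω)
    filter_upwards [hgrad n, a1, a2] with x hx b1 b2
    rcases hx with hx | hx <;> rw [hx]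
    · exact b1.trans hu₁
    · exact b2.trans hu₂
  · rw [nhds_induced, tendsto_comap_iff]
    exact hlim
  · refine W1inf.tendsto_tauWeakStar hΩ hb hlim
      (C := max ‖W1inf.grad u₁‖ ‖W1inf.grad u₂‖) fun n => ?_
    filter_upwards [hgrad n, ae_norm_le_Lp_top (W1inf.grad u₁), ae_norm_le_Lp_top (W1inf.grad u₂)]
      with x hx b1 b2
    rcases hx with hx | hx <;> rw [hx]
    · exact b1.trans (le_max_left _ _)
    · exact b2.trans (le_max_right _ _)

/-- The relaxation of a supremal functional is level convex for every topology with continuous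
affine maps in which uniform convergence together with weak* convergence is convergence. The
construction of `exists_seq_supremalFunctional_le` replaces the difference `z` of two functions by
a fine staircase of `z`, whose gradient takes only the values `0` and `Dz`; so it needs no
competitor beyond the two given functions, and no regularity of the boundary of `Ω`. -/
theorem levelConvex_relaxation_supremalFunctional {N : ℕ} {Ω : Set (RN N)} (hΩ : IsOpen Ω)
    (hb : Bornology.IsBounded Ω) (f : RN N → RN N → EReal) (τ : TopologicalSpace (W1inf Ω))
    (hτ : ∀ (a : ℝ) (b : W1inf Ω), Continuous[τ, τ] fun u => a • u + b)
    (hcl : ∀ (s : Set (W1inf Ω)) (w : ℕ → W1inf Ω) (v : W1inf Ω), (∀ n, w n ∈ s) →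
      Tendsto w atTop (@nhds _ (tauUniform Ω) v) → Tendsto w atTop (@nhds _ (tauWeakStar Ω) v) →
      v ∈ closure[τ] s) :
    LevelConvex (relaxation τ (supremalFunctional Ω f)) := by
  refine levelConvex_relaxation (τ := τ) hτ fun c θ h0 h1 u₁ u₂ hu₁ hu₂ => ?_
  obtain ⟨w, hw, hwu, hww⟩ := exists_seq_supremalFunctional_le hΩ hb f h0.le h1.le hu₁ hu₂
  exact hcl _ w _ hw hwu hww

theorem mainTheorem1 {N : ℕ} (Ω : Set (RN N)) (hΩ : IsOpen Ω) (hb : Bornology.IsBounded Ω)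
    (hconn : IsConnected Ω) (hlip : HasLipschitzBoundary Ω)
    (f : RN N → RN N → EReal)
    (hf : Measurable fun p : Ω × RN N => f p.1 p.2)
    (F : W1inf Ω → EReal) (hF : F = supremalFunctional Ω f)
    (H_Ω : ∃ u : ℕ → W1inf Ω,
      Tendsto (fun n => F (u n)) atTop (𝓝 (⨅ v, F v)) ∧
      ∀ n, limsup (fun ξ : RN N => F (u n + linearW1inf hΩ hb ξ)) (𝓝 0) = F (u n)) :
    LevelConvex (relaxation (tauUniform Ω) F) ∧
      LevelConvex (relaxation (tauWeakStar Ω) F) ∧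
      LevelConvex (relaxation (seqTopology (tauWeakStar Ω)) F) := by
  rw [hF]
  refine ⟨?_, ?_, ?_⟩
  · refine levelConvex_relaxation_supremalFunctional hΩ hb f _ continuous_smul_add_tauUniform ?_
    intro s w v hw hu _
    exact @mem_closure_of_tendsto _ (tauUniform Ω) _ _ _ _ _ _ hu (.of_forall hw)
  · refine levelConvex_relaxation_supremalFunctional hΩ hb f _ continuous_smul_add_tauWeakStar ?_
    intro s w v hw _ hs
    exact @mem_closure_of_tendsto _ (tauWeakStar Ω) _ _ _ _ _ _ hs (.of_forall hw)
  · refine levelConvex_relaxation_supremalFunctional hΩ hb f _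
      (fun a b => continuous_seqTopology (continuous_smul_add_tauWeakStar a b)) ?_
    intro s w v hw _ hs
    exact mem_closure_seqTopology hw hs
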